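/- Let $N\ge 3$, let $\Omega\subset\mathbb R^N$ be a bounded domain and let $X=L^2(\Omega)$ (complex valued). Let $A=-\Delta$ be the negative Dirichlet Laplacian in $X$, with domain $D(A)=\{u\in H_0^1(\Omega):\Delta u\in L^2(\Omega)\}$ (which is $H^2(\Omega)\cap H_0^1(\Omega)$ when $\partial\Omega$ is smooth). Let $A^{1/2}$ be its positive square root, and let $X^{1}=D(A)$ and $X^{1/2}=D(A^{1/2})$ with their graph norms. Put $Y_0=X^{1/2}\times X\times X^{1/2}\times X$. Let $\eta>0$, and let $a_\epsilon:\mathbb R\to\mathbb R$, $\epsilon\in[0,1]$, be functions with $0<a_0\le a_\epsilon(t)\le a_1$ for all $t\in\mathbb R$ and $\epsilon\in[0,1]$, where $a_0,a_1$ are constants. For $t\in\mathbb R$ and $\epsilon\in[0,1]$ let $\mathcal A_\epsilon(t)$ be the unbounded operator in $Y_0$ with domain $X^1\times X^{1/2}\times X^1\times X^{1/2}$ given by $$\mathcal A_\epsilon(t)\begin{bmatrix}u\\v\\w\\z\end{bmatrix}=\begin{bmatrix}-v\\ (A+I)u+\eta A^{1/2}v+a_\epsilon(t)A^{1/2}z\\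 -z\\ -a_\epsilon(t)A^{1/2}v+Aw+\eta A^{1/2}z\end{bmatrix}.$$ Then there are an angle $\theta\in(\pi/2,\pi)$ and a constant $\mathcal C>0$, both independent of $t$ and $\epsilon$, such that, for all $\epsilon\in[0,1]$, all $t\in\mathbb R$ and all $\lambda$ in the sector $\Gamma=\{0\}\cup\{\lambda\in\mathbb C\setminus\{0\}:|\arg\lambda|\le\theta\}$, the operator $\lambda I+\mathcal A_\epsilon(t)$ has a bounded everywhere defined inverse on $Y_0$, and $$\|(\lambda I+\mathcal A_\epsilon(t))^{-1}\|_{\mathcal L(Y_0)}\le\frac{\mathcal C}{1+|\lambda|}.$$ -/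

import Mathlib

noncomputable section

namespace CoupledWave

open MeasureTheory
open scoped ContDiff

/-! ### The Dirichlet Laplacian on `L²(Ω)` -/

/-- The complex Hilbert space `X = L²(Ω)`. -/
abbrev L2 {N : ℕ} (Ω : Set (EuclideanSpace ℝ (Fin N))) : Type :=
  Lp ℂ 2 (volume.restrict Ω)

/-- `φ ∈ C_c^∞(Ω)`, complex valued. -/
structure IsTest {N : ℕ} (Ω : Set (EuclideanSpace ℝ (Fin N)))
    (φ : EuclideanSpace ℝ (Fin N) → ℂ) : Prop where
  smooth : ContDiff ℝ ∞ φ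
  compact : HasCompactSupport φ
  supp : tsupport φ ⊆ Ω

/-- The partial derivative `∂φ/∂xᵢ`. -/
def partialDeriv {N : ℕ} (i : Fin N) (φ : EuclideanSpace ℝ (Fin N) → ℂ)
    (x : EuclideanSpace ℝ (Fin N)) : ℂ :=
  fderiv ℝ φ x (EuclideanSpace.single i 1)

/-- The pairs `(φ, ∇φ)` with `φ ∈ C_c^∞(Ω)`, as elements of `L²(Ω) × L²(Ω)^N`. -/
def testPairs {N : ℕ} (Ω : Set (EuclideanSpace ℝ (Fin N))) :
    Submodule ℂ (L2 Ω × (Fin N → L2 Ω)) where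
  carrier := {p | ∃ φ, IsTest Ω φ ∧ p.1 =ᵐ[volume.restrict Ω] φ ∧
    ∀ i, p.2 i =ᵐ[volume.restrict Ω] partialDeriv i φ}
  zero_mem' := by
    refine ⟨0, ⟨contDiff_const, HasCompactSupport.zero, by simp⟩, Lp.coeFn_zero _ _ _, ?_⟩
    intro i
    have h : partialDeriv i (0 : EuclideanSpace ℝ (Fin N) → ℂ) = 0 := by
      funext x
      simp [partialDeriv]
    rw [h]
    exact Lp.coeFn_zero _ _ _
  add_mem' := by
    rintro p q ⟨φ, hφ, h1, h2⟩ ⟨ψ, hψ, k1, k2⟩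
    refine ⟨φ + ψ, ⟨hφ.smooth.add hψ.smooth, hφ.compact.add hψ.compact,
      (tsupport_add φ ψ).trans (Set.union_subset hφ.supp hψ.supp)⟩, ?_, ?_⟩
    · exact (Lp.coeFn_add _ _).trans (h1.add k1)
    · intro i
      have h : partialDeriv i (φ + ψ) = partialDeriv i φ + partialDeriv i ψ := by
        funext x
        simp [partialDeriv, fderiv_add (hφ.smooth.differentiable (by simp) x)
          (hψ.smooth.differentiable (by simp) x)]
      rw [h]
      exact (Lp.coeFn_add _ _).trans ((h2 i).add (k2 i))
  smul_mem' := by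
    rintro c p ⟨φ, hφ, h1, h2⟩
    refine ⟨c • φ, ⟨hφ.smooth.const_smul c, hφ.compact.smul_left (f := fun _ => c),
      (tsupport_smul_subset_right (fun _ => c) φ).trans hφ.supp⟩, ?_, ?_⟩
    · exact (Lp.coeFn_smul _ _).trans (h1.const_smul c)
    · intro i
      have h : partialDeriv i (c • φ) = c • partialDeriv i φ := by
        funext x
        simp [partialDeriv, fderiv_const_smul (hφ.smooth.differentiable (by simp) x)]
      rw [h]
      exact (Lp.coeFn_smul _ _).trans ((h2 i).const_smul c)

/-- The Sobolev space `H₀¹(Ω)`, the closure of `C_c^∞(Ω)` for the `H¹` norm. An element is the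
pair `(u, ∇u)` of a function and its weak gradient. -/
def H01 {N : ℕ} (Ω : Set (EuclideanSpace ℝ (Fin N))) :
    Submodule ℂ (L2 Ω × (Fin N → L2 Ω)) :=
  (testPairs Ω).topologicalClosure

/-- The graph of the negative Dirichlet Laplacian: the pairs `(u, f)` of elements of `L²(Ω)` with
`u ∈ H₀¹(Ω)` and `-Δu = f` in the weak sense, that is
`∫ ∇u · conj ∇φ = ∫ f · conj φ` for all `φ ∈ C_c^∞(Ω)`. -/
def dirichletGraph {N : ℕ} (Ω : Set (EuclideanSpace ℝ (Fin N))) :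
    Submodule ℂ (L2 Ω × L2 Ω) where
  carrier := {p | ∃ G : Fin N → L2 Ω, (p.1, G) ∈ H01 Ω ∧
    ∀ q ∈ testPairs Ω, ∑ i, inner ℂ (q.2 i) (G i) = inner ℂ q.1 p.2}
  zero_mem' := ⟨0, (H01 Ω).zero_mem, by simp⟩
  add_mem' := by
    rintro p p' ⟨G, hG, h⟩ ⟨G', hG', h'⟩
    refine ⟨G + G', (H01 Ω).add_mem hG hG', fun q hq => ?_⟩
    simp only [Pi.add_apply, Prod.snd_add, inner_add_right, Finset.sum_add_distrib, h q hq,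
      h' q hq]
  smul_mem' := by
    rintro c p ⟨G, hG, h⟩
    refine ⟨c • G, (H01 Ω).smul_mem c hG, fun q hq => ?_⟩
    simp only [Pi.smul_apply, Prod.smul_snd, inner_smul_right, ← Finset.mul_sum, h q hq]

/-- The negative Dirichlet Laplacian `A = -Δ` in `L²(Ω)`, with domain
`D(A) = {u ∈ H₀¹(Ω) : Δu ∈ L²(Ω)}`. If `∂Ω` is smooth, this is `H²(Ω) ∩ H₀¹(Ω)`. -/
def dirichletLaplacian {N : ℕ} (Ω : Set (EuclideanSpace ℝ (Fin N))) : L2 Ω →ₗ.[ℂ] L2 Ω :=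
  (dirichletGraph Ω).toLinearPMap

/-! ### Bounded inverses and the square root -/

/-- `R` is the everywhere defined bounded (two-sided) inverse of the unbounded operator `T`. -/
def IsBoundedInverse {E : Type*} [NormedAddCommGroup E] [NormedSpace ℂ E]
    (T : E →ₗ.[ℂ] E) (R : E →L[ℂ] E) : Prop :=
  (∀ y, ∃ h : R y ∈ T.domain, T ⟨R y, h⟩ = y) ∧ ∀ x : T.domain, R (T x) = x

open Classical in
/-- The bounded inverse `T⁻¹` (`0` if there is none; there is at most one). -/
def boundedInverse {E : Type*} [NormedAddCommGroup E] [NormedSpace ℂ E]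
    (T : E →ₗ.[ℂ] E) : E →L[ℂ] E :=
  if h : ∃ R, IsBoundedInverse T R then h.choose else 0

/-- The square root `T^{1/2}` of a positive self-adjoint operator `T` with bounded inverse:
`T^{-1/2}` is the positive square root of the bounded positive operator `T⁻¹`, and `T^{1/2}` is
the inverse of `T^{-1/2}`, with domain the range of `T^{-1/2}`. -/
def sqrtOp {H : Type*} [NormedAddCommGroup H] [InnerProductSpace ℂ H] [CompleteSpace H]
    (T : H →ₗ.[ℂ] H) : H →ₗ.[ℂ] H :=
  ((CFC.sqrt (boundedInverse T)).toLinearMap.toPMap ⊤).inverse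

/-! ### The phase space -/

section PhaseSpace

variable {H : Type*} [NormedAddCommGroup H] [InnerProductSpace ℂ H]

/-- The domain of `S` with its graph norm `(‖u‖² + ‖S u‖²)^{1/2}`; the element `u` of the domain
is represented by the pair `(u, S u)`. -/
abbrev GraphSpace (S : H →ₗ.[ℂ] H) : Type _ :=
  S.graph.comap (WithLp.linearEquiv 2 ℂ (H × H)).toLinearMap

/-- The element of `GraphSpace S` given by `u ∈ D(S)`. -/
def toGraphSpace (S : H →ₗ.[ℂ] H) : S.domain →ₗ[ℂ] GraphSpace S where
  toFun u := ⟨WithLp.toLp 2 ((u : H), S u), S.mem_graph u⟩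
  map_add' u v := by
    apply Subtype.ext
    simp only [LinearPMap.map_add]
    rfl
  map_smul' c u := by
    apply Subtype.ext
    simp only [LinearPMap.map_smul]
    rfl

/-- The phase space `D(S) × H × D(S) × H`, where `D(S)` carries the graph norm, with the Hilbert
product norm; the components are grouped as `((u, v), (w, z))`. With `S = A^{1/2}` and
`H = X = L²(Ω)` this is `Y₀ = X^{1/2} × X × X^{1/2} × X`. -/
abbrev PhaseSpace (S : H →ₗ.[ℂ] H) : Type _ :=
  WithLp 2 (WithLp 2 (GraphSpace S × H) × WithLp 2 (GraphSpace S × H))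

instance (S : H →ₗ.[ℂ] H) : NormedAddCommGroup (PhaseSpace S) := inferInstance

instance (S : H →ₗ.[ℂ] H) : NormedSpace ℂ (PhaseSpace S) := inferInstance

variable {S : H →ₗ.[ℂ] H}

/-- First component `u`, as an element of `H`. -/
def compU : PhaseSpace S →ₗ[ℂ] H where
  toFun W := W.fst.fst.1.fst
  map_add' _ _ := rfl
  map_smul' _ _ := rfl

/-- Second component `v`. -/
def compV : PhaseSpace S →ₗ[ℂ] H where
  toFun W := W.fst.snd
  map_add' _ _ := rfl
  map_smul' _ _ := rfl

/-- Third component `w`, as an element of `H`. -/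
def compW : PhaseSpace S →ₗ[ℂ] H where
  toFun W := W.snd.fst.1.fst
  map_add' _ _ := rfl
  map_smul' _ _ := rfl

/-- Fourth component `z`. -/
def compZ : PhaseSpace S →ₗ[ℂ] H where
  toFun W := W.snd.snd
  map_add' _ _ := rfl
  map_smul' _ _ := rfl

/-- The domain `D(A) × D(S) × D(A) × D(S)`. -/
def matrixDomain (A S : H →ₗ.[ℂ] H) : Submodule ℂ (PhaseSpace S) :=
  A.domain.comap compU ⊓ S.domain.comap compV ⊓ A.domain.comap compW ⊓ S.domain.comap compZ

/-- `u`, as an element of `D(A)`. -/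
def domU (A S : H →ₗ.[ℂ] H) : matrixDomain A S →ₗ[ℂ] A.domain :=
  (compU.domRestrict (matrixDomain A S)).codRestrict A.domain fun W => W.2.1.1.1

/-- `v`, as an element of `D(S)`. -/
def domV (A S : H →ₗ.[ℂ] H) : matrixDomain A S →ₗ[ℂ] S.domain :=
  (compV.domRestrict (matrixDomain A S)).codRestrict S.domain fun W => W.2.1.1.2

/-- `w`, as an element of `D(A)`. -/
def domW (A S : H →ₗ.[ℂ] H) : matrixDomain A S →ₗ[ℂ] A.domain :=
  (compW.domRestrict (matrixDomain A S)).codRestrict A.domain fun W => W.2.1.2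

/-- `z`, as an element of `D(S)`. -/
def domZ (A S : H →ₗ.[ℂ] H) : matrixDomain A S →ₗ[ℂ] S.domain :=
  (compZ.domRestrict (matrixDomain A S)).codRestrict S.domain fun W => W.2.2

/-- The operator matrix
```
  [  0      -I     0    0   ]
  [ A+I     η S    0   a S  ]
  [  0       0     0   -I   ]
  [  0     -a S    A   η S  ]
```
on the phase space, with domain `D(A) × D(S) × D(A) × D(S)`. -/
def matrixOp (A S : H →ₗ.[ℂ] H) (η a : ℝ) : PhaseSpace S →ₗ.[ℂ] PhaseSpace S where
  domain := matrixDomain A S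
  toFun :=
    { toFun := fun W => WithLp.toLp 2
        (WithLp.toLp 2 (-toGraphSpace S (domV A S W),
          A (domU A S W) + (domU A S W : H) + (η : ℂ) • S (domV A S W)
            + (a : ℂ) • S (domZ A S W)),
         WithLp.toLp 2 (-toGraphSpace S (domZ A S W),
          -((a : ℂ) • S (domV A S W)) + A (domW A S W) + (η : ℂ) • S (domZ A S W)))
      map_add' := by
        intro W W'
        simp only [map_add, LinearPMap.map_add, Submodule.coe_add, ← WithLp.toLp_add,
          Prod.mk_add_mk]
        congr 4 <;> module
      map_smul' := by
        intro c W
        simp only [map_smul, LinearPMap.map_smul, Submodule.coe_smul, ← WithLp.toLp_smul,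
          Prod.smul_mk, RingHom.id_apply]
        congr 4 <;> module }

end PhaseSpace

/-- The operator `λ I + T`, with the domain of `T`. -/
def shift {E : Type*} [NormedAddCommGroup E] [NormedSpace ℂ E] (μ : ℂ) (T : E →ₗ.[ℂ] E) :
    E →ₗ.[ℂ] E :=
  (μ • LinearMap.id : E →ₗ[ℂ] E) +ᵥ T

/-- The fractional power `A^{1/2}` of the negative Dirichlet Laplacian. -/
def sqrtLaplacian {N : ℕ} (Ω : Set (EuclideanSpace ℝ (Fin N))) : L2 Ω →ₗ.[ℂ] L2 Ω :=
  sqrtOp (dirichletLaplacian Ω)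

/-- The phase space `Y₀ = X^{1/2} × X × X^{1/2} × X`, with `X = L²(Ω)` and
`X^{1/2} = D(A^{1/2})`. -/
abbrev Y0 {N : ℕ} (Ω : Set (EuclideanSpace ℝ (Fin N))) : Type :=
  PhaseSpace (sqrtLaplacian Ω)

/-- The operator `𝒜` in `Y₀` for the damping constant `η` and the value `a` of the coupling. -/
def waveOp {N : ℕ} (Ω : Set (EuclideanSpace ℝ (Fin N))) (η a : ℝ) : Y0 Ω →ₗ.[ℂ] Y0 Ω :=
  matrixOp (dirichletLaplacian Ω) (sqrtLaplacian Ω) η a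

/-- The closed sector `{λ : |arg λ| ≤ θ}` around the positive real axis, of half-angle `θ` and
with its vertex `0` included. -/
def sector (θ : ℝ) : Set ℂ := {μ | |μ.arg| ≤ θ}

end CoupledWave

end

noncomputable section

namespace CoupledWave

open MeasureTheory
open scoped ContDiff

/-! Put K = A^{-1/2}, a bounded positive operator. In the coordinates (A^{1/2}u, v, A^{1/2}w, z) the
phase space is H⁴ with an equivalent norm, and the domain of the operator is exactly K·H⁴, an
element being K y with y = (Au, A^{1/2}v, Aw, A^{1/2}z). There λ + 𝒜 sends K y to M(K) y, where M is
the 4×4 matrix `waveMatrix`, polynomial in K. The resolvent is therefore K M(K)⁻¹, and the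
continuous functional calculus (`exists_inverse_waveMatrix`) reduces the theorem to bounding the
entries of κ M(κ)⁻¹ by C/(1+|λ|), uniformly for real κ in [0, ‖K‖].

For Re λ ≥ 0 the scalar bound comes from an energy identity: damping controls v and z, and the
second and fourth equations then control u and w. The solution is O(κ) uniformly in λ, so the
equations can be solved for λκ times each unknown and divided by κ, which gives the decay in |λ|
(`symbol_bound_right`). A perturbation argument widens the half-plane to a sector (`symbol_bound`).

The analytic input is that A has a bounded positive inverse
(`exists_isBoundedInverse_dirichletLaplacian`); it follows from the Poincaré inequality and duality.
-/

/-! ### Scalar resolvent estimates, uniform in the spectral variable κ. -/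

/-- The energy identity for the scalar resolvent system. -/
theorem symbol_energy (l u v w z f g h k : ℂ) (κ η a : ℝ)
    (h1 : l * κ * u - v = κ * f)
    (h2 : (1 + κ * κ) * u + (l * κ + η) * v + a * z = κ * g)
    (h3 : l * κ * w - z = κ * h)
    (h4 : -a * v + w + (l * κ + η) * z = κ * k) :
    l.re * κ * ((1 + κ ^ 2) * ‖u‖ ^ 2 + ‖v‖ ^ 2 + ‖w‖ ^ 2 + ‖z‖ ^ 2)
        + η * (‖v‖ ^ 2 + ‖z‖ ^ 2)
      = κ * ((1 + κ ^ 2) * (f * star u).re + (g * star v).re + (h * star w).re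
        + (k * star z).re) := by
  simp only [Complex.ext_iff, Complex.add_re, Complex.add_im, Complex.sub_re, Complex.sub_im,
    Complex.mul_re, Complex.mul_im, Complex.ofReal_re, Complex.ofReal_im, Complex.one_re,
    Complex.one_im, Complex.neg_re, Complex.neg_im] at h1 h2 h3 h4
  simp only [Complex.sq_norm, Complex.normSq_apply, Complex.star_def, Complex.mul_re,
    Complex.conj_re, Complex.conj_im]
  -- Real parts of the equations tested with (1+κ²)ū, v̄, w̄, z̄. The weight 1+κ² cancels the u–v
  -- terms, and the a-coupling cancels by antisymmetry.
  linear_combination (1 + κ ^ 2) * (u.re * h1.1 + u.im * h1.2) + v.re * h2.1 + v.im * h2.2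
    + w.re * h3.1 + w.im * h3.2 + z.re * h4.1 + z.im * h4.2

theorem re_mul_star_le (f u : ℂ) (m : ℝ) (hf : ‖f‖ ≤ m) : (f * star u).re ≤ m * ‖u‖ := by
  calc (f * star u).re ≤ ‖f * star u‖ := Complex.re_le_norm _
    _ = ‖f‖ * ‖u‖ := by rw [norm_mul, norm_star]
    _ ≤ m * ‖u‖ := by gcongr

/-- Bound for the displacement in terms of the velocities; `b` is the coefficient of `u`. -/
theorem displacement_sq_le (l u v z f g : ℂ) (κ b η a a₁ m : ℝ) (hκ : 0 ≤ κ) (hb : 1 ≤ b)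
    (hη : 0 ≤ η) (ha : |a| ≤ a₁) (hf : ‖f‖ ≤ m) (hg : ‖g‖ ≤ m)
    (h1 : l * κ * u - v = κ * f)
    (h2 : b * u + (l * κ + η) * v + a * z = κ * g) :
    ‖u‖ ^ 2 ≤ 4 * (κ * m * (‖u‖ + ‖v‖)) + 2 * (1 + η ^ 2) * ‖v‖ ^ 2
      + 2 * a₁ ^ 2 * ‖z‖ ^ 2 := by
  have hl : ‖l * κ * u‖ ≤ ‖v‖ + κ * m := by
    have : l * κ * u = v + κ * f := by linear_combination h1
    rw [this]
    refine (norm_add_le _ _).trans ?_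
    rw [norm_mul, Complex.norm_real, Real.norm_of_nonneg hκ]
    gcongr
  -- Multiplying by u makes λ appear only in λκu, which the first equation bounds without λ.
  have e : (b : ℂ) * u * u = κ * g * u - v * (l * κ * u) - η * v * u - a * z * u := by
    linear_combination u * h2
  have n1 : b * ‖u‖ ^ 2 ≤ κ * m * ‖u‖ + ‖v‖ * (‖v‖ + κ * m) + η * ‖v‖ * ‖u‖
      + a₁ * ‖z‖ * ‖u‖ := by
    calc b * ‖u‖ ^ 2 = ‖(b : ℂ) * u * u‖ := by
          rw [norm_mul, norm_mul, Complex.norm_real, Real.norm_of_nonneg (by linarith)]; ring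
      _ ≤ ‖κ * g * u‖ + ‖v * (l * κ * u)‖ + ‖η * v * u‖ + ‖a * z * u‖ := by
          rw [e]
          exact (norm_sub_le _ _).trans (add_le_add_left ((norm_sub_le _ _).trans
            (add_le_add_left (norm_sub_le _ _) _)) _)
      _ ≤ _ := by
          rw [norm_mul (κ * g), norm_mul (κ : ℂ), norm_mul v, norm_mul (η * v), norm_mul (η : ℂ),
            norm_mul (a * z), norm_mul (a : ℂ), Complex.norm_real, Complex.norm_real,
            Complex.norm_real, Real.norm_of_nonneg hκ, Real.norm_of_nonneg hη, Real.norm_eq_abs]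
          gcongr
  have n2 : ‖u‖ ^ 2 ≤ b * ‖u‖ ^ 2 := le_mul_of_one_le_left (by positivity) hb
  -- Young's inequality: the η and a terms each cost a quarter of ‖u‖², absorbed on the left.
  have n3 := sq_nonneg (2 * η * ‖v‖ - ‖u‖)
  have n4 := sq_nonneg (2 * a₁ * ‖z‖ - ‖u‖)
  have hm : 0 ≤ κ * m := mul_nonneg hκ ((norm_nonneg _).trans hf)
  have n5 := mul_nonneg hm (norm_nonneg u)
  have n6 := mul_nonneg hm (norm_nonneg v)
  nlinarith

/-- The energy identity bounds ‖v‖² + ‖z‖² by a multiple of κ m y, with y the sum of the four norms;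
the displacement bounds then do the same for y², and y cancels. Keeping the factor κ on the right is
essential: it later allows division by κ. -/
theorem symbol_bound_aux (l u v w z f g h k : ℂ) (κ k₀ η a a₁ m : ℝ) (hl : 0 ≤ l.re)
    (hκ : 0 ≤ κ) (hκk : κ ≤ k₀) (hη : 0 < η) (ha : |a| ≤ a₁)
    (hf : ‖f‖ ≤ m) (hg : ‖g‖ ≤ m) (hh : ‖h‖ ≤ m) (hk : ‖k‖ ≤ m)
    (h1 : l * κ * u - v = κ * f)
    (h2 : (1 + κ * κ) * u + (l * κ + η) * v + a * z = κ * g)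
    (h3 : l * κ * w - z = κ * h)
    (h4 : -a * v + w + (l * κ + η) * z = κ * k) :
    ‖u‖ + ‖v‖ + ‖w‖ + ‖z‖ ≤
      4 * (8 + (3 + 2 * η ^ 2 + 2 * a₁ ^ 2) * ((1 + k₀ ^ 2) / η)) * (κ * m) := by
  have E := symbol_energy l u v w z f g h k κ η a h1 h2 h3 h4
  set y := ‖u‖ + ‖v‖ + ‖w‖ + ‖z‖ with hy
  have hm : 0 ≤ m := (norm_nonneg _).trans hf
  have hk2 : κ ^ 2 ≤ k₀ ^ 2 := by gcongr
  have E1 : η * (‖v‖ ^ 2 + ‖z‖ ^ 2) ≤ (1 + k₀ ^ 2) * (κ * m * y) := by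
    have p : 0 ≤ l.re * κ * ((1 + κ ^ 2) * ‖u‖ ^ 2 + ‖v‖ ^ 2 + ‖w‖ ^ 2 + ‖z‖ ^ 2) := by
      positivity
    have q : (1 + κ ^ 2) * (f * star u).re + (g * star v).re + (h * star w).re
        + (k * star z).re ≤ (1 + k₀ ^ 2) * (m * y) := by
      have q1 : (1 + κ ^ 2) * (f * star u).re ≤ (1 + k₀ ^ 2) * (m * ‖u‖) := by
        refine (mul_le_mul_of_nonneg_left (re_mul_star_le f u m hf) (by positivity)).trans ?_
        gcongr
      have aux (x : ℝ) (hx : 0 ≤ x) : x ≤ (1 + k₀ ^ 2) * x := by nlinarith [sq_nonneg k₀]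
      have q2 := (re_mul_star_le g v m hg).trans (aux _ (by positivity))
      have q3 := (re_mul_star_le h w m hh).trans (aux _ (by positivity))
      have q4 := (re_mul_star_le k z m hk).trans (aux _ (by positivity))
      rw [hy]
      linarith
    calc _ ≤ κ * ((1 + κ ^ 2) * (f * star u).re + (g * star v).re + (h * star w).re
        + (k * star z).re) := by linarith
      _ ≤ κ * ((1 + k₀ ^ 2) * (m * y)) := by gcongr
      _ = _ := by ring
  have E2 : ‖v‖ ^ 2 + ‖z‖ ^ 2 ≤ (1 + k₀ ^ 2) / η * (κ * m * y) := by
    rw [div_mul_eq_mul_div, le_div_iff₀ hη]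
    linarith
  have U := displacement_sq_le l u v z f g κ (1 + κ ^ 2) η a a₁ m hκ (by nlinarith) hη.le ha hf hg
    h1 (by push_cast; linear_combination h2)
  -- The (w, z) pair satisfies the same system with b = 1 and the coupling sign reversed.
  have W := displacement_sq_le l w z v h k κ 1 η (-a) a₁ m hκ le_rfl hη.le (by simpa using ha)
    hh hk h3 (by push_cast; linear_combination h4)
  have hS : ‖u‖ ^ 2 + ‖v‖ ^ 2 + ‖w‖ ^ 2 + ‖z‖ ^ 2 ≤
      8 * (κ * m * y) + (3 + 2 * η ^ 2 + 2 * a₁ ^ 2) * (‖v‖ ^ 2 + ‖z‖ ^ 2) := by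
    have r : 0 ≤ κ * m := by positivity
    have r1 := mul_nonneg r (norm_nonneg u)
    have r2 := mul_nonneg r (norm_nonneg v)
    have r3 := mul_nonneg r (norm_nonneg w)
    have r4 := mul_nonneg r (norm_nonneg z)
    rw [hy]
    linarith
  have hy2 : y ^ 2 ≤ 4 * (‖u‖ ^ 2 + ‖v‖ ^ 2 + ‖w‖ ^ 2 + ‖z‖ ^ 2) := by
    rw [hy]
    linarith [sq_nonneg (‖u‖ - ‖v‖), sq_nonneg (‖u‖ - ‖w‖), sq_nonneg (‖u‖ - ‖z‖),
      sq_nonneg (‖v‖ - ‖w‖), sq_nonneg (‖v‖ - ‖z‖), sq_nonneg (‖w‖ - ‖z‖)]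
  have hy0 : 0 ≤ y := by positivity
  have fin : y * y ≤
      4 * (8 + (3 + 2 * η ^ 2 + 2 * a₁ ^ 2) * ((1 + k₀ ^ 2) / η)) * (κ * m) * y := by
    have := mul_le_mul_of_nonneg_left E2 (show 0 ≤ 3 + 2 * η ^ 2 + 2 * a₁ ^ 2 by positivity)
    calc y * y = y ^ 2 := by ring
      _ ≤ 4 * (8 * (κ * m * y) + (3 + 2 * η ^ 2 + 2 * a₁ ^ 2) *
          ((1 + k₀ ^ 2) / η * (κ * m * y))) := by linarith
      _ = _ := by ring
  rcases hy0.eq_or_lt with h0 | h0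
  · rw [← h0]; positivity
  · exact le_of_mul_le_mul_right fin h0

theorem norm_spectral_mul_le (l u f x : ℂ) (κ m X : ℝ) (hκ : 0 ≤ κ) (hf : ‖f‖ ≤ m)
    (e : l * κ * u + x = κ * f) (hx : ‖x‖ ≤ X) : ‖l‖ * κ * ‖u‖ ≤ κ * m + X := by
  calc ‖l‖ * κ * ‖u‖ = ‖l * κ * u‖ := by
        rw [norm_mul, norm_mul, Complex.norm_real, Real.norm_of_nonneg hκ]
    _ = ‖κ * f - x‖ := by congr 1; linear_combination e
    _ ≤ ‖κ * f‖ + ‖x‖ := norm_sub_le _ _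
    _ ≤ κ * m + X := by
        rw [norm_mul, Complex.norm_real, Real.norm_of_nonneg hκ]; gcongr

/-- The scalar resolvent estimate in the closed right half-plane. -/
theorem symbol_bound_right (k₀ η a₁ : ℝ) (hk₀ : 0 ≤ k₀) (hη : 0 < η) (ha₁ : 0 ≤ a₁) :
    ∃ C : ℝ, 0 < C ∧ ∀ (l u v w z f g h k : ℂ) (κ a m : ℝ), 0 ≤ l.re → 0 ≤ κ → κ ≤ k₀ →
      |a| ≤ a₁ → ‖f‖ ≤ m → ‖g‖ ≤ m → ‖h‖ ≤ m → ‖k‖ ≤ m →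
      l * κ * u - v = κ * f →
      (1 + κ * κ) * u + (l * κ + η) * v + a * z = κ * g →
      l * κ * w - z = κ * h →
      -a * v + w + (l * κ + η) * z = κ * k →
      (1 + ‖l‖) * (‖u‖ + ‖v‖ + ‖w‖ + ‖z‖) ≤ C * m := by
  set C₀ : ℝ := 4 * (8 + (3 + 2 * η ^ 2 + 2 * a₁ ^ 2) * ((1 + k₀ ^ 2) / η)) with hC₀
  set c : ℝ := 2 + k₀ ^ 2 + η + a₁ with hc
  have hC₀p : 0 < C₀ := by positivity
  have hcp : 0 < c := by positivity
  refine ⟨C₀ * k₀ + (4 + c * C₀), by positivity, ?_⟩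
  intro l u v w z f g h k κ a m hl hκ hκk ha hf hg hh hk h1 h2 h3 h4
  have hY := symbol_bound_aux l u v w z f g h k κ k₀ η a a₁ m hl hκ hκk hη ha hf hg hh hk
    h1 h2 h3 h4
  rw [← hC₀] at hY
  set y := ‖u‖ + ‖v‖ + ‖w‖ + ‖z‖ with hy
  have hy0 : 0 ≤ y := by positivity
  have hm : 0 ≤ m := (norm_nonneg _).trans hf
  have hy1 : y ≤ C₀ * k₀ * m := by
    calc y ≤ C₀ * (κ * m) := hY
      _ ≤ C₀ * (k₀ * m) := by gcongr
      _ = C₀ * k₀ * m := by ring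
  have hy2 : ‖l‖ * y ≤ (4 + c * C₀) * m := by
    have i1 := norm_spectral_mul_le l u f (-v) κ m ‖v‖ hκ hf (by linear_combination h1) (by simp)
    have i2 := norm_spectral_mul_le l v g ((1 + κ * κ) * u + η * v + a * z) κ m
      ((1 + k₀ ^ 2) * ‖u‖ + η * ‖v‖ + a₁ * ‖z‖) hκ hg (by linear_combination h2) (by
        refine (norm_add₃_le).trans ?_
        have : (1 + κ * κ : ℂ) = ((1 + κ ^ 2 : ℝ) : ℂ) := by push_cast; ring
        rw [this, norm_mul, norm_mul, norm_mul, Complex.norm_real, Complex.norm_real,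
          Complex.norm_real, Real.norm_of_nonneg hη.le, Real.norm_of_nonneg (by positivity),
          Real.norm_eq_abs]
        gcongr)
    have i3 := norm_spectral_mul_le l w h (-z) κ m ‖z‖ hκ hh (by linear_combination h3) (by simp)
    have i4 := norm_spectral_mul_le l z k (-a * v + w + η * z) κ m
      (a₁ * ‖v‖ + ‖w‖ + η * ‖z‖) hκ hk (by linear_combination h4) (by
        refine (norm_add₃_le).trans ?_
        rw [norm_mul, norm_mul, norm_neg, Complex.norm_real,
          Complex.norm_real, Real.norm_of_nonneg hη.le, Real.norm_eq_abs]
        gcongr)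
    have hs : ‖l‖ * κ * y ≤ 4 * (κ * m) + c * y := by
      rw [hy, hc]
      nlinarith [norm_nonneg u, norm_nonneg v, norm_nonneg w, norm_nonneg z,
        mul_nonneg hη.le (norm_nonneg u), mul_nonneg ha₁ (norm_nonneg u),
        mul_nonneg hη.le (norm_nonneg w), mul_nonneg ha₁ (norm_nonneg w),
        mul_nonneg (sq_nonneg k₀) (norm_nonneg v), mul_nonneg (sq_nonneg k₀) (norm_nonneg w),
        mul_nonneg (sq_nonneg k₀) (norm_nonneg z)]
    -- At κ = 0 the previous bound forces y = 0; otherwise it supplies the factor κ to be cancelled.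
    rcases hκ.eq_or_lt with h0 | h0
    · have : y = 0 := le_antisymm (by simpa [← h0] using hY) hy0
      rw [this, mul_zero]
      positivity
    · refine le_of_mul_le_mul_left ?_ h0
      have := mul_le_mul_of_nonneg_left hY hcp.le
      calc κ * (‖l‖ * y) = ‖l‖ * κ * y := by ring
        _ ≤ 4 * (κ * m) + c * (C₀ * (κ * m)) := by linarith
        _ = _ := by ring
  calc (1 + ‖l‖) * y = y + ‖l‖ * y := by ring
    _ ≤ _ := by rw [add_mul]; exact add_le_add hy1 hy2

theorem neg_sin_mul_norm_le_re {δ : ℝ} (hδ : δ ≤ Real.pi / 2) {l : ℂ}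
    (hl : l ∈ sector (Real.pi / 2 + δ)) : -Real.sin δ * ‖l‖ ≤ l.re := by
  have h : Real.cos (Real.pi / 2 + δ) ≤ Real.cos |l.arg| :=
    Real.cos_le_cos_of_nonneg_of_le_pi (abs_nonneg _) (by linarith) hl
  rw [Real.cos_abs, add_comm, Real.cos_add_pi_div_two] at h
  rw [← Complex.norm_mul_cos_arg l, mul_comm ‖l‖]
  gcongr

/-- The scalar resolvent estimate in a sector of half-angle larger than `π / 2`. -/
theorem symbol_bound (k₀ η a₁ : ℝ) (hk₀ : 0 ≤ k₀) (hη : 0 < η) (ha₁ : 0 ≤ a₁) :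
    ∃ θ : ℝ, Real.pi / 2 < θ ∧ θ < Real.pi ∧ ∃ C : ℝ, 0 < C ∧
      ∀ (l u v w z f g h k : ℂ) (κ a m : ℝ), l ∈ sector θ → 0 ≤ κ → κ ≤ k₀ →
      |a| ≤ a₁ → ‖f‖ ≤ m → ‖g‖ ≤ m → ‖h‖ ≤ m → ‖k‖ ≤ m →
      l * κ * u - v = κ * f →
      (1 + κ * κ) * u + (l * κ + η) * v + a * z = κ * g →
      l * κ * w - z = κ * h →
      -a * v + w + (l * κ + η) * z = κ * k →
      (1 + ‖l‖) * (‖u‖ + ‖v‖ + ‖w‖ + ‖z‖) ≤ C * m := by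
  obtain ⟨C, hC, H⟩ := symbol_bound_right k₀ η a₁ hk₀ hη ha₁
  -- Chosen so that σ + Cσ = 1/2: after shifting λ by r = σ|λ| into the right half-plane, the
  -- resulting errors amount to half of |λ|y and are absorbed, at the cost of doubling C.
  set σ : ℝ := 1 / (2 * (1 + C)) with hσ
  have hσ0 : 0 < σ := by positivity
  have hσ1 : σ < 1 := by rw [hσ, div_lt_one (by positivity)]; linarith
  have hσC : σ + C * σ = 1 / 2 := by rw [hσ]; field_simp
  have hd0 : 0 < Real.arcsin σ := Real.arcsin_pos.2 hσ0
  have hd1 : Real.arcsin σ < Real.pi / 2 := Real.arcsin_lt_pi_div_two.2 hσ1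
  refine ⟨Real.pi / 2 + Real.arcsin σ, by linarith, by linarith, 2 * C, by positivity, ?_⟩
  intro l u v w z f g h k κ a m hl hκ hκk ha hf hg hh hk h1 h2 h3 h4
  have hre := neg_sin_mul_norm_le_re hd1.le hl
  rw [Real.sin_arcsin (by linarith) hσ1.le] at hre
  set y := ‖u‖ + ‖v‖ + ‖w‖ + ‖z‖ with hy
  set r : ℝ := σ * ‖l‖ with hr
  have hr0 : 0 ≤ r := by positivity
  have hb (f x : ℂ) (hf : ‖f‖ ≤ m) (hx : ‖x‖ ≤ y) : ‖f + r * x‖ ≤ m + r * y := by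
    refine (norm_add_le _ _).trans ?_
    rw [norm_mul, Complex.norm_real, Real.norm_of_nonneg hr0]
    gcongr
  have nu := norm_nonneg u
  have nv := norm_nonneg v
  have nw := norm_nonneg w
  have nz := norm_nonneg z
  -- The same vector solves the system at λ + r once rκ times each unknown is moved into the data.
  have key := H (l + r) u v w z (f + r * u) (g + r * v) (h + r * w) (k + r * z) κ a (m + r * y)
    (by simp; linarith) hκ hκk ha (hb _ _ hf (by linarith)) (hb _ _ hg (by linarith))
    (hb _ _ hh (by linarith)) (hb _ _ hk (by linarith)) (by linear_combination h1)
    (by linear_combination h2) (by linear_combination h3) (by linear_combination h4)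
  have hn : ‖l‖ - r ≤ ‖l + r‖ := by
    have := norm_sub_le (l + r) r
    rw [add_sub_cancel_right, Complex.norm_real, Real.norm_of_nonneg hr0] at this
    linarith
  have hy0 : 0 ≤ y := by positivity
  have h5 : (1 + (‖l‖ - r)) * y ≤ C * (m + r * y) := by
    refine le_trans ?_ key
    gcongr
  have h6 : (σ + C * σ) * (‖l‖ * y) = 1 / 2 * (‖l‖ * y) := by rw [hσC]
  rw [hr] at h5
  nlinarith

/-! ### The matrix symbol and its inversion by functional calculus. -/

/-- The symbol of the resolvent equation, as a matrix of functions of `k = A^{-1/2}`. -/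
def waveMatrix {R : Type*} [Ring R] [Algebra ℂ R] (k : R) (l : ℂ) (η a : ℝ) :
    Matrix (Fin 4) (Fin 4) R :=
  !![l • k, -1, 0, 0;
     1 + k * k, l • k + (η : ℂ) • 1, 0, (a : ℂ) • 1;
     0, 0, l • k, -1;
     0, -((a : ℂ) • 1), 1, l • k + (η : ℂ) • 1]

/-- Used for two homomorphisms from C(σ(K)): evaluation at a point of the spectrum, and the
functional calculus into the operator algebra. -/
theorem waveMatrix_map {R R' : Type*} [Ring R] [Algebra ℂ R] [Ring R'] [Algebra ℂ R']
    (φ : R →ₐ[ℂ] R') (k : R) (l : ℂ) (η a : ℝ) :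
    (waveMatrix k l η a).map φ = waveMatrix (φ k) l η a := by
  ext i j
  fin_cases i <;> fin_cases j <;> simp [waveMatrix, -Complex.coe_smul]

theorem waveMatrix_mulVec_scalar (κ η a : ℝ) (l : ℂ) (Y F : Fin 4 → ℂ)
    (h : (waveMatrix (κ : ℂ) l η a).mulVec Y = F) :
    l * κ * Y 0 - Y 1 = F 0 ∧
    (1 + κ * κ) * Y 0 + (l * κ + η) * Y 1 + a * Y 3 = F 1 ∧
    l * κ * Y 2 - Y 3 = F 2 ∧
    -a * Y 1 + Y 2 + (l * κ + η) * Y 3 = F 3 := by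
  subst h
  simp [waveMatrix, Matrix.mulVec, dotProduct, Fin.sum_univ_four, sub_eq_add_neg]

open scoped ComplexOrder in
/-- Inversion of the symbol by the continuous functional calculus. -/
theorem exists_inverse_waveMatrix {E : Type*} [CStarAlgebra E] [PartialOrder E]
    [StarOrderedRing E] (K : E) (hK : 0 ≤ K) (η a₁ : ℝ) (hη : 0 < η) (ha₁ : 0 ≤ a₁) :
    ∃ θ : ℝ, Real.pi / 2 < θ ∧ θ < Real.pi ∧ ∃ C : ℝ, 0 < C ∧
      ∀ l ∈ sector θ, ∀ a : ℝ, |a| ≤ a₁ → ∃ Q : Matrix (Fin 4) (Fin 4) E,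
        waveMatrix K l η a * Q = 1 ∧ Q * waveMatrix K l η a = 1 ∧
        ∀ i j, ‖K * Q i j‖ ≤ C / (1 + ‖l‖) := by
  obtain ⟨θ, hθ, hθ', C, hC, H⟩ := symbol_bound ‖K‖ η a₁ (norm_nonneg _) hη ha₁
  refine ⟨θ, hθ, hθ', C, hC, fun l hl a ha => ?_⟩
  have hn : IsStarNormal K := hK.isSelfAdjoint.isStarNormal
  have hx (x : spectrum ℂ K) : ∃ κ : ℝ, 0 ≤ κ ∧ κ ≤ ‖K‖ ∧ (x : ℂ) = κ := by
    have h0 : (0 : ℂ) ≤ x := spectrum_nonneg_of_nonneg hK x.2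
    have h1 : ((x : ℂ).re : ℂ) = x := Complex.conj_eq_iff_re.1 (Complex.conj_eq_iff_im.2
      (Complex.nonneg_iff.1 h0).2.symm)
    refine ⟨(x : ℂ).re, (Complex.nonneg_iff.1 h0).1, ?_, h1.symm⟩
    -- In the zero algebra the spectrum is empty, so a spectral point rules it out.
    have : Nontrivial E := by
      by_contra hE
      have := not_nontrivial_iff_subsingleton.1 hE
      exact (spectrum.of_subsingleton (R := ℂ) K).subset x.2
    exact (Complex.re_le_norm _).trans (spectrum.norm_le_norm_of_mem x.2)
  let k : C(spectrum ℂ K, ℂ) := (ContinuousMap.id ℂ).restrict (spectrum ℂ K)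
  let Φ : C(spectrum ℂ K, ℂ) →ₐ[ℂ] E := (cfcHom hn : C(spectrum ℂ K, ℂ) →⋆ₐ[ℂ] E).toAlgHom
  have hΦk : Φ k = K := cfcHom_id hn
  let M := waveMatrix k l η a
  have hM (x : spectrum ℂ K) : M.map (ContinuousMap.evalAlgHom ℂ ℂ x) =
      waveMatrix (x : ℂ) l η a := waveMatrix_map _ _ _ _ _
  -- Invertibility is pointwise on the spectrum, and the estimate with zero data m = 0 excludes a
  -- kernel, also at κ = 0.
  have hdet : IsUnit M.det := by
    rw [ContinuousMap.isUnit_iff_forall_ne_zero]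
    intro x hx0
    obtain ⟨κ, hκ, hκK, hκx⟩ := hx x
    have hd : (waveMatrix (κ : ℂ) l η a).det = 0 := by
      rw [← hκx, ← hM x]
      exact ((ContinuousMap.evalAlgHom ℂ ℂ x).map_det M).symm.trans hx0
    obtain ⟨Y, hY, hY0⟩ := Matrix.exists_mulVec_eq_zero_iff.2 hd
    obtain ⟨h1, h2, h3, h4⟩ := waveMatrix_mulVec_scalar κ η a l Y 0 hY0
    have := H l (Y 0) (Y 1) (Y 2) (Y 3) 0 0 0 0 κ a 0 hl hκ hκK ha (by simp) (by simp) (by simp)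
      (by simp) (by simpa using h1) (by simpa using h2) (by simpa using h3) (by simpa using h4)
    have hs : ‖Y 0‖ + ‖Y 1‖ + ‖Y 2‖ + ‖Y 3‖ ≤ 0 := by
      rw [mul_zero] at this
      exact nonpos_of_mul_nonpos_right this (by positivity)
    apply hY
    have := norm_nonneg (Y 0)
    have := norm_nonneg (Y 1)
    have := norm_nonneg (Y 2)
    have := norm_nonneg (Y 3)
    funext i
    fin_cases i
    · exact norm_le_zero_iff.1 (show ‖Y 0‖ ≤ 0 by linarith)
    · exact norm_le_zero_iff.1 (show ‖Y 1‖ ≤ 0 by linarith)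
    · exact norm_le_zero_iff.1 (show ‖Y 2‖ ≤ 0 by linarith)
    · exact norm_le_zero_iff.1 (show ‖Y 3‖ ≤ 0 by linarith)
  have hMK : M.map Φ = waveMatrix K l η a := by
    rw [waveMatrix_map Φ k l η a, hΦk]
  refine ⟨(M⁻¹).map Φ, ?_, ?_, ?_⟩
  · rw [← hMK, ← Matrix.map_mul, Matrix.mul_nonsing_inv _ hdet, Matrix.map_one _ (map_zero _) (map_one _)]
  · rw [← hMK, ← Matrix.map_mul, Matrix.nonsing_inv_mul _ hdet, Matrix.map_one _ (map_zero _) (map_one _)]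
  · intro i j
    have hnorm : ‖K * Φ (M⁻¹ i j)‖ = ‖k * M⁻¹ i j‖ :=
      calc ‖K * Φ (M⁻¹ i j)‖ = ‖Φ k * Φ (M⁻¹ i j)‖ := by rw [hΦk]
        _ = ‖Φ (k * M⁻¹ i j)‖ := by rw [← map_mul]
        _ = ‖k * M⁻¹ i j‖ := norm_cfcHom K _ hn
    change ‖K * Φ (M⁻¹ i j)‖ ≤ _
    rw [hnorm, ContinuousMap.norm_le _ (by positivity)]
    intro x
    obtain ⟨κ, hκ, hκK, hκx⟩ := hx x
    -- κ times column j of the inverse solves the scalar system whose data is the j-th basis vector,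
    -- so the estimate applies with m = 1.
    have hMx : (waveMatrix (κ : ℂ) l η a).mulVec (fun i => κ * M⁻¹ i j x) =
        fun i => κ * (1 : Matrix (Fin 4) (Fin 4) ℂ) i j := by
      have := congrArg (fun P => P.map (ContinuousMap.evalAlgHom ℂ ℂ x))
        (Matrix.mul_nonsing_inv _ hdet)
      simp only [Matrix.map_mul, Matrix.map_one _ (map_zero _) (map_one _), hM] at this
      rw [hκx] at this
      rw [← this]
      funext i
      simp [Matrix.mulVec, dotProduct, Matrix.mul_apply, Finset.mul_sum]
      exact Finset.sum_congr rfl fun _ _ => by ring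
    obtain ⟨h1, h2, h3, h4⟩ := waveMatrix_mulVec_scalar κ η a l _ _ hMx
    have h1le (i : Fin 4) : ‖(1 : Matrix (Fin 4) (Fin 4) ℂ) i j‖ ≤ 1 := by
      rw [Matrix.one_apply]; split <;> simp
    have := H l _ _ _ _ _ _ _ _ κ a 1 hl hκ hκK ha (h1le 0) (h1le 1) (h1le 2) (h1le 3) h1 h2 h3 h4
    rw [ContinuousMap.mul_apply, le_div_iff₀ (by positivity)]
    have hk : k x = κ := hκx
    rw [hk]
    have n0 := norm_nonneg ((κ : ℂ) * M⁻¹ 0 j x)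
    have n1 := norm_nonneg ((κ : ℂ) * M⁻¹ 1 j x)
    have n2 := norm_nonneg ((κ : ℂ) * M⁻¹ 2 j x)
    have n3 := norm_nonneg ((κ : ℂ) * M⁻¹ 3 j x)
    have : ‖(κ : ℂ) * M⁻¹ i j x‖ ≤ ‖(κ : ℂ) * M⁻¹ 0 j x‖ + ‖(κ : ℂ) * M⁻¹ 1 j x‖
        + ‖(κ : ℂ) * M⁻¹ 2 j x‖ + ‖(κ : ℂ) * M⁻¹ 3 j x‖ := by
      fin_cases i <;> simp only [Fin.zero_eta, Fin.mk_one, Fin.reduceFinMk] <;> linarith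
    calc _ ≤ (‖(κ : ℂ) * M⁻¹ 0 j x‖ + ‖(κ : ℂ) * M⁻¹ 1 j x‖
        + ‖(κ : ℂ) * M⁻¹ 2 j x‖ + ‖(κ : ℂ) * M⁻¹ 3 j x‖) * (1 + ‖l‖) := by gcongr
      _ ≤ C := by linarith

/-! ### From an inverse of the symbol to the resolvent on the phase space. -/

section Resolvent

variable {H : Type*} [NormedAddCommGroup H] [InnerProductSpace ℂ H]

/-- The action of a matrix of operators on a vector. -/
def opMulVec (M : Matrix (Fin 4) (Fin 4) (H →L[ℂ] H)) : (Fin 4 → H) →ₗ[ℂ] (Fin 4 → H) where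
  toFun y i := ∑ j, M i j (y j)
  map_add' y y' := by funext i; simp [Finset.sum_add_distrib]
  map_smul' c y := by funext i; simp [Finset.smul_sum]

theorem opMulVec_apply (M : Matrix (Fin 4) (Fin 4) (H →L[ℂ] H)) (y : Fin 4 → H) (i : Fin 4) :
    opMulVec M y i = ∑ j, M i j (y j) := rfl

theorem opMulVec_mul (M M' : Matrix (Fin 4) (Fin 4) (H →L[ℂ] H)) (y : Fin 4 → H) :
    opMulVec (M * M') y = opMulVec M (opMulVec M' y) := by
  funext i
  simp only [opMulVec_apply, Matrix.mul_apply, sum_apply,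
    mul_apply_eq_comp, map_sum]
  exact Finset.sum_comm

theorem opMulVec_one (y : Fin 4 → H) : opMulVec 1 y = y := by
  funext i
  rw [opMulVec_apply, Finset.sum_eq_single i]
  · simp
  · intro j _ hj
    simp [Matrix.one_apply_ne hj.symm]
  · simp

variable {S : H →ₗ.[ℂ] H}

/-- The components `(S u, v, S w, z)`. -/
def coords : PhaseSpace S →ₗ[ℂ] (Fin 4 → H) where
  toFun W := ![W.fst.fst.1.snd, W.fst.snd, W.snd.fst.1.snd, W.snd.snd]
  map_add' W W' := by funext i; fin_cases i <;> rfl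
  map_smul' c W := by funext i; fin_cases i <;> rfl

theorem norm_coords_le (W : PhaseSpace S) (i : Fin 4) : ‖coords W i‖ ≤ ‖W‖ := by
  have h1 : ‖W.fst‖ ≤ ‖W‖ := WithLp.norm_fst_le _ W
  have h2 : ‖W.snd‖ ≤ ‖W‖ := WithLp.norm_snd_le _ W
  fin_cases i
  · exact (WithLp.norm_snd_le _ W.fst.fst.1).trans ((WithLp.norm_fst_le _ W.fst).trans h1)
  · exact (WithLp.norm_snd_le _ W.fst).trans h1
  · exact (WithLp.norm_snd_le _ W.snd.fst.1).trans ((WithLp.norm_fst_le _ W.snd).trans h2)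
  · exact (WithLp.norm_snd_le _ W.snd).trans h2

theorem norm_toLp_prod_le {E F : Type*} [NormedAddCommGroup E] [NormedAddCommGroup F] (x : E)
    (y : F) : ‖(WithLp.toLp 2 (x, y) : WithLp 2 (E × F))‖ ≤ ‖x‖ + ‖y‖ := by
  rw [WithLp.prod_norm_eq_of_L2]
  refine Real.sqrt_le_iff.2 ⟨by positivity, ?_⟩
  change ‖x‖ ^ 2 + ‖y‖ ^ 2 ≤ _
  nlinarith [norm_nonneg x, norm_nonneg y, mul_nonneg (norm_nonneg x) (norm_nonneg y)]

variable {K : H →L[ℂ] H} (hS : ∀ p : H × H, p ∈ S.graph ↔ p.1 = K p.2)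

/-- The element of `GraphSpace S` with `S u = x`, when `S` is the inverse of `K`. -/
def graphLift : H →ₗ[ℂ] GraphSpace S where
  toFun x := ⟨WithLp.toLp 2 (K x, x), (hS (K x, x)).2 rfl⟩
  map_add' x y := by
    apply Subtype.ext
    simp only [map_add]
    rfl
  map_smul' c x := by
    apply Subtype.ext
    simp only [map_smul]
    rfl

include hS in
theorem graphSpace_fst (p : GraphSpace S) : p.1.fst = K p.1.snd := (hS (p.1.fst, p.1.snd)).1 p.2

include hS in
theorem graphSpace_ext {p q : GraphSpace S} (h : p.1.snd = q.1.snd) : p = q := by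
  apply Subtype.ext
  apply (WithLp.equiv 2 (H × H)).injective
  apply Prod.ext
  · exact (graphSpace_fst hS p).trans ((congrArg K h).trans (graphSpace_fst hS q).symm)
  · exact h

include hS in
theorem coords_injective : Function.Injective (coords (S := S)) := by
  intro W W' h
  apply (WithLp.equiv 2 _).injective
  apply Prod.ext
  · apply (WithLp.equiv 2 _).injective
    apply Prod.ext
    · exact graphSpace_ext hS (congrFun h 0)
    · exact congrFun h 1
  · apply (WithLp.equiv 2 _).injective
    apply Prod.ext
    · exact graphSpace_ext hS (congrFun h 2)
    · exact congrFun h 3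

/-- The element of the phase space with components `(S u, v, S w, z)`. -/
def ofCoords : (Fin 4 → H) →ₗ[ℂ] PhaseSpace S where
  toFun Y := WithLp.toLp 2 (WithLp.toLp 2 (graphLift hS (Y 0), Y 1),
    WithLp.toLp 2 (graphLift hS (Y 2), Y 3))
  map_add' Y Y' := by
    simp only [Pi.add_apply, map_add]
    rfl
  map_smul' c Y := by
    simp only [Pi.smul_apply, map_smul]
    rfl

theorem coords_ofCoords (Y : Fin 4 → H) : coords (ofCoords hS Y) = Y := by
  funext i
  fin_cases i <;> rfl

theorem norm_graphLift_le (x : H) : ‖graphLift hS x‖ ≤ (1 + ‖K‖) * ‖x‖ := by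
  calc ‖graphLift hS x‖ ≤ ‖K x‖ + ‖x‖ := norm_toLp_prod_le (K x) x
    _ ≤ ‖K‖ * ‖x‖ + ‖x‖ := by gcongr; exact K.le_opNorm x
    _ = _ := by ring

theorem norm_ofCoords_le (Y : Fin 4 → H) : ‖ofCoords hS Y‖ ≤ (1 + ‖K‖) * ∑ i, ‖Y i‖ := by
  have h1 := norm_toLp_prod_le (WithLp.toLp 2 (graphLift hS (Y 0), Y 1))
    (WithLp.toLp 2 (graphLift hS (Y 2), Y 3))
  have h2 := norm_toLp_prod_le (graphLift hS (Y 0)) (Y 1)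
  have h3 := norm_toLp_prod_le (graphLift hS (Y 2)) (Y 3)
  have h4 := norm_graphLift_le hS (Y 0)
  have h5 := norm_graphLift_le hS (Y 2)
  have h6 := mul_nonneg (norm_nonneg K) (norm_nonneg (Y 1))
  have h7 := mul_nonneg (norm_nonneg K) (norm_nonneg (Y 3))
  rw [Fin.sum_univ_four]
  change ‖WithLp.toLp 2 (WithLp.toLp 2 (graphLift hS (Y 0), Y 1),
    WithLp.toLp 2 (graphLift hS (Y 2), Y 3))‖ ≤ _
  linarith

/-- The operator on the phase space given by a bounded matrix of operators in the components
`(S u, v, S w, z)`. -/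
def matrixCLM (P : Matrix (Fin 4) (Fin 4) (H →L[ℂ] H)) (c : ℝ) (hP : ∀ i j, ‖P i j‖ ≤ c) :
    PhaseSpace S →L[ℂ] PhaseSpace S :=
  LinearMap.mkContinuous (ofCoords hS ∘ₗ opMulVec P ∘ₗ coords) ((1 + ‖K‖) * (16 * c)) fun W => by
    have h (i : Fin 4) : ‖opMulVec P (coords W) i‖ ≤ 4 * c * ‖W‖ := by
      rw [opMulVec_apply]
      refine (norm_sum_le _ _).trans ?_
      have hj (j : Fin 4) : ‖P i j (coords W j)‖ ≤ c * ‖W‖ :=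
        (P i j).le_of_opNorm_le_of_le (hP i j) (norm_coords_le W j)
      refine (Finset.sum_le_sum fun j _ => hj j).trans ?_
      simp
      linarith
    refine (norm_ofCoords_le hS _).trans ?_
    rw [mul_assoc]
    gcongr
    refine (Finset.sum_le_sum fun j _ => h j).trans ?_
    simp
    linarith

theorem norm_matrixCLM_le (P : Matrix (Fin 4) (Fin 4) (H →L[ℂ] H)) (c : ℝ)
    (hP : ∀ i j, ‖P i j‖ ≤ c) : ‖matrixCLM hS P c hP‖ ≤ (1 + ‖K‖) * (16 * c) := by
  have hc : 0 ≤ c := (norm_nonneg _).trans (hP 0 0)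
  exact LinearMap.mkContinuous_norm_le _ (by positivity) _

theorem coords_matrixCLM (P : Matrix (Fin 4) (Fin 4) (H →L[ℂ] H)) (c : ℝ)
    (hP : ∀ i j, ‖P i j‖ ≤ c) (W : PhaseSpace S) :
    coords (matrixCLM hS P c hP W) = opMulVec P (coords W) :=
  coords_ofCoords hS _

variable {A : H →ₗ.[ℂ] H} (hA : ∀ p : H × H, p ∈ A.graph ↔ p.1 = K (K p.2))

include hS in
theorem compU_eq (W : PhaseSpace S) : compU W = K (coords W 0) := graphSpace_fst hS W.fst.fst

include hS in
theorem compW_eq (W : PhaseSpace S) : compW W = K (coords W 2) := graphSpace_fst hS W.snd.fst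

-- K is injective because its inverse S is single-valued: K x = 0 puts (0, x) in the graph of S.
include hS in
theorem eq_zero_of_map_eq_zero {x : H} (hx : K x = 0) : x = 0 :=
  S.graph_fst_eq_zero_snd ((hS (0, x)).2 hx.symm) rfl

include hS hA in
/-- `(S u, v, S w, z) = K y` with `y = (A u, S v, A w, S z)` on the domain. -/
theorem exists_coords_eq_of_mem {W : PhaseSpace S} (hW : W ∈ matrixDomain A S) :
    ∃ y : Fin 4 → H, ∀ i, coords W i = K (y i) := by
  obtain ⟨⟨⟨hu, hv⟩, hw⟩, hz⟩ := hW
  have key {x x' : H} (h : K x = K (K x')) : x = K x' := by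
    rw [← sub_eq_zero]
    exact eq_zero_of_map_eq_zero hS (by rw [map_sub, h, sub_self])
  have h0 := (hA _).1 (A.mem_graph ⟨_, hu⟩)
  have h1 := (hS _).1 (S.mem_graph ⟨_, hv⟩)
  have h2 := (hA _).1 (A.mem_graph ⟨_, hw⟩)
  have h3 := (hS _).1 (S.mem_graph ⟨_, hz⟩)
  refine ⟨![A ⟨_, hu⟩, S ⟨_, hv⟩, A ⟨_, hw⟩, S ⟨_, hz⟩], fun i => ?_⟩
  fin_cases i
  · exact key ((compU_eq hS W).symm.trans h0)
  · exact h1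
  · exact key ((compW_eq hS W).symm.trans h2)
  · exact h3

include hS hA in
theorem mem_matrixDomain {W : PhaseSpace S} {y : Fin 4 → H} (h : ∀ i, coords W i = K (y i)) :
    W ∈ matrixDomain A S := by
  refine ⟨⟨⟨?_, ?_⟩, ?_⟩, ?_⟩
  · exact A.mem_domain_of_mem_graph ((hA (_, y 0)).2 ((compU_eq hS W).trans (congrArg K (h 0))))
  · exact S.mem_domain_of_mem_graph ((hS (_, y 1)).2 (h 1))
  · exact A.mem_domain_of_mem_graph ((hA (_, y 2)).2 ((compW_eq hS W).trans (congrArg K (h 2))))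
  · exact S.mem_domain_of_mem_graph ((hS (_, y 3)).2 (h 3))

-- This conjugates the unbounded operator to the bounded matrix: since A = K⁻² and S = K⁻¹, the
-- terms Au, Sv, Aw, Sz are the entries of y, and u itself is K² y₀, the source of the entry 1 + K².
include hS hA in
theorem coords_shift_matrixOp (l : ℂ) (η a : ℝ) (W : matrixDomain A S) {y : Fin 4 → H}
    (h : ∀ i, coords (W : PhaseSpace S) i = K (y i)) :
    coords (shift l (matrixOp A S η a) W) = opMulVec (waveMatrix K l η a) y := by
  have eu : A (domU A S W) = y 0 :=
    ((A.image_iff (domU A S W).2).2 ((hA (_, y 0)).2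
      ((compU_eq hS W.1).trans (congrArg K (h 0))))).symm
  have ev : S (domV A S W) = y 1 :=
    ((S.image_iff (domV A S W).2).2 ((hS (_, y 1)).2 (h 1))).symm
  have ew : A (domW A S W) = y 2 :=
    ((A.image_iff (domW A S W).2).2 ((hA (_, y 2)).2
      ((compW_eq hS W.1).trans (congrArg K (h 2))))).symm
  have ez : S (domZ A S W) = y 3 :=
    ((S.image_iff (domZ A S W).2).2 ((hS (_, y 3)).2 (h 3))).symm
  have hu : (domU A S W : H) = K (K (y 0)) := (compU_eq hS W.1).trans (congrArg K (h 0))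
  funext i
  rw [opMulVec_apply, Fin.sum_univ_four]
  fin_cases i
  · change l • coords (W : PhaseSpace S) 0 + -(S (domV A S W)) = _
    rw [h, ev]
    simp [waveMatrix]
  · change l • coords (W : PhaseSpace S) 1 + (A (domU A S W) + (domU A S W : H)
      + (η : ℂ) • S (domV A S W) + (a : ℂ) • S (domZ A S W)) = _
    rw [h, eu, hu, ev, ez]
    simp [waveMatrix, -Complex.coe_smul]
    abel
  · change l • coords (W : PhaseSpace S) 2 + -(S (domZ A S W)) = _
    rw [h, ez]
    simp [waveMatrix]
  · change l • coords (W : PhaseSpace S) 3 + (-((a : ℂ) • S (domV A S W)) + A (domW A S W)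
      + (η : ℂ) • S (domZ A S W)) = _
    rw [h, ev, ew, ez]
    simp [waveMatrix, -Complex.coe_smul]
    abel

include hA in
/-- An inverse of the symbol gives the resolvent of the operator matrix. -/
theorem isBoundedInverse_matrixCLM (l : ℂ) (η a c : ℝ)
    (Q P : Matrix (Fin 4) (Fin 4) (H →L[ℂ] H))
    (hQ : waveMatrix K l η a * Q = 1) (hQ' : Q * waveMatrix K l η a = 1)
    (hPQ : ∀ i j, P i j = K * Q i j)
    (hP : ∀ i j, ‖P i j‖ ≤ c) :
    IsBoundedInverse (shift l (matrixOp A S η a)) (matrixCLM hS P c hP) := by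
  have hPy (y : Fin 4 → H) (i : Fin 4) : opMulVec P y i = K (opMulVec Q y i) := by
    simp [opMulVec_apply, hPQ]
  constructor
  · intro F
    have h (i : Fin 4) : coords (matrixCLM hS P c hP F) i = K (opMulVec Q (coords F) i) := by
      rw [coords_matrixCLM, hPy]
    refine ⟨mem_matrixDomain hS hA h, ?_⟩
    apply coords_injective hS
    refine (coords_shift_matrixOp hS hA l η a ⟨_, mem_matrixDomain hS hA h⟩ h).trans ?_
    rw [← opMulVec_mul, hQ, opMulVec_one]
  · intro W
    obtain ⟨y, hy⟩ := exists_coords_eq_of_mem hS hA W.2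
    apply coords_injective hS
    rw [coords_matrixCLM, coords_shift_matrixOp hS hA l η a W hy]
    funext i
    rw [hPy, ← opMulVec_mul, hQ', opMulVec_one, hy]

end Resolvent

/-! ### The square root of an operator with bounded positive inverse. -/

section SquareRoot

variable {H : Type*} [NormedAddCommGroup H] [InnerProductSpace ℂ H] [CompleteSpace H]

omit [CompleteSpace H] in
theorem IsBoundedInverse.mem_graph_iff {T : H →ₗ.[ℂ] H} {B : H →L[ℂ] H}
    (h : IsBoundedInverse T B) (p : H × H) : p ∈ T.graph ↔ p.1 = B p.2 := by
  constructor
  · intro hp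
    obtain ⟨y, hy, hy'⟩ := T.mem_graph_iff.1 hp
    rw [← hy', h.2, hy]
  · intro hp
    obtain ⟨hB, hT⟩ := h.1 p.2
    exact T.mem_graph_iff.2 ⟨⟨_, hB⟩, hp.symm, hT⟩

omit [CompleteSpace H] in
theorem IsBoundedInverse.boundedInverse_eq {T : H →ₗ.[ℂ] H} {B : H →L[ℂ] H}
    (h : IsBoundedInverse T B) : boundedInverse T = B := by
  have hex : ∃ R, IsBoundedInverse T R := ⟨B, h⟩
  rw [boundedInverse, dif_pos hex]
  ext y
  exact (h.mem_graph_iff (_, y)).1 ((hex.choose_spec.mem_graph_iff (_, y)).2 rfl)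

theorem IsBoundedInverse.mem_graph_sqrtOp_iff {T : H →ₗ.[ℂ] H} {B : H →L[ℂ] H}
    (h : IsBoundedInverse T B) (hB : 0 ≤ B) (p : H × H) :
    p ∈ (sqrtOp T).graph ↔ p.1 = CFC.sqrt B p.2 := by
  -- The inverse of a partial map has the swapped graph only for an injective map; √B x = 0 gives B
  -- x = 0, hence x = T(B x) = 0.
  have hker : ((CFC.sqrt (boundedInverse T)).toLinearMap.toPMap ⊤).toFun.ker = ⊥ := by
    rw [LinearMap.ker_eq_bot']
    rintro ⟨x, hx⟩ hx0
    have h0 : CFC.sqrt B x = 0 := by rw [← h.boundedInverse_eq]; exact hx0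
    have hBx : B x = 0 := by
      rw [← CFC.sqrt_mul_sqrt_self B hB, mul_apply_eq_comp, h0, map_zero]
    obtain ⟨hm, hT⟩ := h.1 x
    have : (⟨B x, hm⟩ : T.domain) = 0 := Subtype.ext hBx
    rw [this, T.map_zero] at hT
    exact Subtype.ext hT.symm
  rw [sqrtOp, LinearPMap.inverse_graph hker, h.boundedInverse_eq]
  constructor
  · rintro ⟨q, hq, rfl⟩
    obtain ⟨y, hy, hy'⟩ := (LinearPMap.mem_graph_iff _).1 hq
    change q.2 = CFC.sqrt B q.1
    rw [← hy, ← hy']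
    rfl
  · intro hp
    exact ⟨(p.2, p.1), (LinearPMap.mem_graph_iff _).2 ⟨⟨p.2, trivial⟩, rfl, hp.symm⟩, rfl⟩

/-- The resolvent estimate for the operator matrix of a positive operator. -/
theorem exists_sector_resolvent_bound {T : H →ₗ.[ℂ] H} {B : H →L[ℂ] H}
    (h : IsBoundedInverse T B) (hB : 0 ≤ B) (η a₁ : ℝ) (hη : 0 < η) (ha₁ : 0 ≤ a₁) :
    ∃ θ : ℝ, Real.pi / 2 < θ ∧ θ < Real.pi ∧ ∃ C : ℝ, 0 < C ∧
      ∀ l ∈ sector θ, ∀ a : ℝ, |a| ≤ a₁ →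
        ∃ R : PhaseSpace (sqrtOp T) →L[ℂ] PhaseSpace (sqrtOp T),
          IsBoundedInverse (shift l (matrixOp T (sqrtOp T) η a)) R ∧ ‖R‖ ≤ C / (1 + ‖l‖) := by
  obtain ⟨θ, hθ, hθ', C, hC, H⟩ :=
    exists_inverse_waveMatrix (CFC.sqrt B) (CFC.sqrt_nonneg B) η a₁ hη ha₁
  refine ⟨θ, hθ, hθ', (1 + ‖CFC.sqrt B‖) * (16 * C), by positivity, fun l hl a ha => ?_⟩
  obtain ⟨Q, h1, h2, h4⟩ := H l hl a ha
  have hS := h.mem_graph_sqrtOp_iff hB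
  have hA (p : _) : p ∈ T.graph ↔ p.1 = CFC.sqrt B (CFC.sqrt B p.2) := by
    rw [h.mem_graph_iff, ← mul_apply_eq_comp, CFC.sqrt_mul_sqrt_self B hB]
  refine ⟨matrixCLM hS (fun i j => CFC.sqrt B * Q i j) _ h4,
    isBoundedInverse_matrixCLM hS hA l η a _ Q _ h1 h2 (fun _ _ => rfl) h4, ?_⟩
  refine (norm_matrixCLM_le hS _ _ h4).trans_eq ?_
  ring

end SquareRoot

/-! ### The Dirichlet Laplacian: Poincaré inequality and bounded positive inverse. -/

section Dirichlet

variable {N : ℕ} {Ω : Set (EuclideanSpace ℝ (Fin N))}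

theorem norm_le_sum_norm_single {F : Type*} [NormedAddCommGroup F] [NormedSpace ℝ F]
    (L : EuclideanSpace ℝ (Fin N) →L[ℝ] F) : ‖L‖ ≤ ∑ i, ‖L (EuclideanSpace.single i 1)‖ := by
  refine L.opNorm_le_bound (by positivity) fun x => ?_
  have hx : L x = ∑ i, x i • L (EuclideanSpace.single i 1) := by
    conv_lhs => rw [← (EuclideanSpace.basisFun (Fin N) ℝ).sum_repr x]
    simp
  rw [hx, Finset.sum_mul]
  refine (norm_sum_le _ _).trans (Finset.sum_le_sum fun i _ => ?_)
  rw [norm_smul, mul_comm]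
  gcongr
  exact PiLp.norm_apply_le x i

theorem IsTest.continuous_partialDeriv {φ : EuclideanSpace ℝ (Fin N) → ℂ} (hφ : IsTest Ω φ)
    (i : Fin N) : Continuous (partialDeriv i φ) :=
  (hφ.smooth.continuous_fderiv (by simp)).clm_apply continuous_const

theorem IsTest.hasCompactSupport_partialDeriv {φ : EuclideanSpace ℝ (Fin N) → ℂ}
    (hφ : IsTest Ω φ) (i : Fin N) : HasCompactSupport (partialDeriv i φ) :=
  hφ.compact.fderiv_apply ℝ _

/-- The Poincaré inequality for test functions. -/
theorem poincare_testPairs (hN : 3 ≤ N) (hΩb : Bornology.IsBounded Ω) :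
    ∃ C : ℝ, 0 ≤ C ∧ ∀ p ∈ testPairs Ω, ‖p.1‖ ≤ C * ∑ i, ‖p.2 i‖ := by
  refine ⟨eLpNormLESNormFDerivOfLeConst ℂ (volume : Measure (EuclideanSpace ℝ (Fin N))) Ω 2 2,
    NNReal.coe_nonneg _, ?_⟩
  rintro p ⟨φ, hφ, h1, h2⟩
  have hs : Function.support φ ⊆ Ω := (subset_tsupport φ).trans hφ.supp
  -- The Gagliardo–Nirenberg–Sobolev inequality at exponent 2 requires 2 < N, which is where N ≥ 3
  -- enters.
  have S := eLpNorm_le_eLpNorm_fderiv (F := ℂ) (volume : Measure (EuclideanSpace ℝ (Fin N)))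
    (hφ.smooth.of_le (by simp)) hs (p := 2) (by norm_num)
    (by rw [finrank_euclideanSpace_fin]; exact_mod_cast hN) hΩb
  have hs' : Function.support (fun x => ‖fderiv ℝ φ x‖) ⊆ Ω := fun x hx =>
    hφ.supp (support_fderiv_subset ℝ fun h0 => hx (by simp [h0]))
  have hD : eLpNorm (fderiv ℝ φ) 2 volume ≤ ∑ i, eLpNorm (p.2 i) 2 (volume.restrict Ω) := by
    rw [← eLpNorm_norm (fderiv ℝ φ), ← eLpNorm_restrict_eq_of_support_subset hs']
    calc eLpNorm (fun x => ‖fderiv ℝ φ x‖) 2 (volume.restrict Ω)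
        ≤ eLpNorm (∑ i, fun x => ‖partialDeriv i φ x‖) 2 (volume.restrict Ω) := by
          refine eLpNorm_mono_real fun x => ?_
          rw [Finset.sum_apply, norm_norm]
          exact norm_le_sum_norm_single _
      _ ≤ ∑ i, eLpNorm (fun x => ‖partialDeriv i φ x‖) 2 (volume.restrict Ω) :=
          eLpNorm_sum_le (fun i _ => (hφ.continuous_partialDeriv i).norm.aestronglyMeasurable)
            (by norm_num)
      _ = _ := by
          refine Finset.sum_congr rfl fun i _ => ?_
          rw [eLpNorm_norm, eLpNorm_congr_ae (h2 i)]
  have hfin : ∑ i, eLpNorm (p.2 i) 2 (volume.restrict Ω) ≠ ⊤ :=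
    ENNReal.sum_ne_top.2 fun i _ => Lp.eLpNorm_ne_top _
  have key : eLpNorm p.1 2 (volume.restrict Ω) ≤
      eLpNormLESNormFDerivOfLeConst ℂ (volume : Measure (EuclideanSpace ℝ (Fin N))) Ω 2 2
        * ∑ i, eLpNorm (p.2 i) 2 (volume.restrict Ω) := by
    rw [eLpNorm_congr_ae h1, eLpNorm_restrict_eq_of_support_subset hs]
    refine S.trans ?_
    gcongr
    exact hD
  have := ENNReal.toReal_mono (ENNReal.mul_ne_top ENNReal.coe_ne_top hfin) key
  rw [ENNReal.toReal_mul, ENNReal.toReal_sum fun i _ => Lp.eLpNorm_ne_top _] at this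
  simpa [Lp.norm_def] using this

/-- The Poincaré inequality in `H₀¹(Ω)`. -/
theorem poincare_H01 (hN : 3 ≤ N) (hΩb : Bornology.IsBounded Ω) :
    ∃ C : ℝ, 0 ≤ C ∧ ∀ p ∈ H01 Ω, ‖p.1‖ ≤ C * ‖(WithLp.toLp 2 p.2 : PiLp 2 fun _ => L2 Ω)‖ := by
  obtain ⟨C, hC, h⟩ := poincare_testPairs (Ω := Ω) hN hΩb
  refine ⟨C * N, by positivity, fun p hp => ?_⟩
  have h' : ‖p.1‖ ≤ C * ∑ i, ‖p.2 i‖ := by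
    have hcl : IsClosed {q : L2 Ω × (Fin N → L2 Ω) | ‖q.1‖ ≤ C * ∑ i, ‖q.2 i‖} :=
      isClosed_le (by fun_prop) (by fun_prop)
    exact closure_minimal h hcl hp
  refine h'.trans ?_
  rw [mul_assoc]
  gcongr
  calc ∑ i, ‖p.2 i‖ ≤ ∑ _i : Fin N, ‖(WithLp.toLp 2 p.2 : PiLp 2 fun _ => L2 Ω)‖ :=
        Finset.sum_le_sum fun i _ =>
          PiLp.norm_apply_le (WithLp.toLp 2 p.2 : PiLp 2 fun _ => L2 Ω) i
    _ = _ := by simp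

/-- Test functions define elements of `H₀¹(Ω)`. -/
theorem IsTest.exists_mem_testPairs {φ : EuclideanSpace ℝ (Fin N) → ℂ} (hφ : IsTest Ω φ) :
    ∃ q ∈ testPairs Ω, q.1 =ᵐ[volume.restrict Ω] φ := by
  have h1 : MemLp φ 2 (volume.restrict Ω) :=
    (hφ.smooth.continuous.memLp_of_hasCompactSupport hφ.compact).restrict Ω
  have h2 (i : Fin N) : MemLp (partialDeriv i φ) 2 (volume.restrict Ω) :=
    ((hφ.continuous_partialDeriv i).memLp_of_hasCompactSupport
      (hφ.hasCompactSupport_partialDeriv i)).restrict Ω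
  exact ⟨(h1.toLp, fun i => (h2 i).toLp), ⟨φ, hφ, h1.coeFn_toLp, fun i => (h2 i).coeFn_toLp⟩,
    h1.coeFn_toLp⟩

/-- Test functions are dense in `L²(Ω)`. -/
theorem eq_zero_of_inner_testPairs (hΩ : IsOpen Ω) (f : L2 Ω)
    (h : ∀ q ∈ testPairs Ω, inner ℂ q.1 f = 0) : f = 0 := by
  have hloc : LocallyIntegrable f (volume.restrict Ω) :=
    (Lp.memLp f).locallyIntegrable (by norm_num)
  -- Real-valued test functions already suffice, which also makes the conjugation in the inner
  -- product harmless.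
  have key := hΩ.ae_eq_zero_of_integral_contDiff_smul_eq_zero (hloc.locallyIntegrableOn Ω) (by
    intro g hg hgc hgΩ
    have hφ : IsTest Ω fun x => (g x : ℂ) := by
      have hsub : tsupport (fun x => (g x : ℂ)) ⊆ tsupport g :=
        closure_mono fun x hx hx0 => hx (by simp [hx0])
      exact ⟨Complex.ofRealCLM.contDiff.comp hg, hgc.comp_left (g := Complex.ofReal) rfl,
        hsub.trans hgΩ⟩
    obtain ⟨q, hq, hqφ⟩ := hφ.exists_mem_testPairs
    rw [← h q hq, L2.inner_def]
    refine integral_congr_ae ?_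
    filter_upwards [hqφ] with x hx
    rw [hx]
    simp [mul_comm])
  rw [Lp.eq_zero_iff_ae_eq_zero]
  filter_upwards [key, ae_restrict_mem hΩ.measurableSet] with x hx hxΩ
  exact hx hxΩ

/-- The weak formulation extends to test functions in `H₀¹(Ω)`. -/
theorem weak_formulation_H01 {f : L2 Ω} {G : Fin N → L2 Ω}
    (h : ∀ q ∈ testPairs Ω, ∑ i, inner ℂ (q.2 i) (G i) = inner ℂ q.1 f) :
    ∀ q ∈ H01 Ω, ∑ i, inner ℂ (q.2 i) (G i) = inner ℂ q.1 f := by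
  have hcl : IsClosed {q : L2 Ω × (Fin N → L2 Ω) |
      ∑ i, inner ℂ (q.2 i) (G i) = inner ℂ q.1 f} :=
    isClosed_eq (by fun_prop) (by fun_prop)
  exact fun q hq => closure_minimal h hcl hq

/-- Testing the weak equation with u itself gives ‖G‖² = ⟨u, f⟩. The case u = 0 makes the graph
single-valued without a separate closability argument; the case f = 0 gives injectivity. -/
theorem gradient_eq_zero {u f : L2 Ω} {G : Fin N → L2 Ω} (hG : (u, G) ∈ H01 Ω)
    (h : ∀ q ∈ testPairs Ω, ∑ i, inner ℂ (q.2 i) (G i) = inner ℂ q.1 f)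
    (h0 : inner ℂ u f = 0) : G = 0 := by
  have h1 := weak_formulation_H01 h _ hG
  have h2 : inner ℂ (WithLp.toLp 2 G : PiLp 2 fun _ => L2 Ω) (WithLp.toLp 2 G) = 0 := by
    rw [PiLp.inner_apply]
    exact h1.trans h0
  exact congrArg WithLp.ofLp (inner_self_eq_zero.1 h2)

theorem dirichletGraph_snd_eq_zero (hΩ : IsOpen Ω) (p : L2 Ω × L2 Ω)
    (hp : p ∈ dirichletGraph Ω) (hp0 : p.1 = 0) : p.2 = 0 := by
  obtain ⟨G, hG, h⟩ := hp
  have hG0 := gradient_eq_zero hG h (by rw [hp0, inner_zero_left])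
  refine eq_zero_of_inner_testPairs hΩ _ fun q hq => ?_
  rw [← h q hq, hG0]
  simp

theorem dirichletGraph_fst_eq_zero (hN : 3 ≤ N) (hΩb : Bornology.IsBounded Ω)
    {u : L2 Ω} (hu : (u, 0) ∈ dirichletGraph Ω) : u = 0 := by
  obtain ⟨G, hG, h⟩ := hu
  have hG0 := gradient_eq_zero hG h (inner_zero_right _)
  obtain ⟨C, -, hC⟩ := poincare_H01 (Ω := Ω) hN hΩb
  have := hC _ hG
  rw [hG0] at this
  simpa using this

/-- The gradient on `H₀¹(Ω)`. -/
def gradient (Ω : Set (EuclideanSpace ℝ (Fin N))) :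
    H01 Ω →L[ℂ] PiLp 2 (fun _ : Fin N => L2 Ω) :=
  (PiLp.continuousLinearEquiv 2 ℂ (fun _ : Fin N => L2 Ω)).symm.toContinuousLinearMap ∘L
    ContinuousLinearMap.snd ℂ (L2 Ω) (Fin N → L2 Ω) ∘L (H01 Ω).subtypeL

theorem gradient_apply (p : H01 Ω) : gradient Ω p = WithLp.toLp 2 p.1.2 := rfl

/-- The operator `J J*`, for `J` defined on a closed subspace. -/
theorem exists_nonneg_comp_adjoint {E F : Type*} [NormedAddCommGroup E] [InnerProductSpace ℂ E]
    [NormedAddCommGroup F] [InnerProductSpace ℂ F] [CompleteSpace F] (D : Submodule ℂ E)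
    [CompleteSpace D] (J : D →L[ℂ] F) :
    ∃ B : F →L[ℂ] F, 0 ≤ B ∧ ∃ J' : F → D, (∀ f, B f = J (J' f)) ∧
      ∀ (g : D) (f : F), inner ℂ (g : E) (J' f : E) = inner ℂ (J g) f :=
  ⟨J ∘L J.adjoint, (ContinuousLinearMap.nonneg_iff_isPositive _).2
    (ContinuousLinearMap.isPositive_self_comp_adjoint J), J.adjoint, fun _ => rfl,
    fun g f => J.adjoint_inner_right g f⟩

/-- The solution operator of the weak Dirichlet problem. -/
theorem exists_nonneg_solution (hN : 3 ≤ N) (hΩb : Bornology.IsBounded Ω) :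
    ∃ B : L2 Ω →L[ℂ] L2 Ω, 0 ≤ B ∧ ∀ f, (B f, f) ∈ dirichletGraph Ω := by
  obtain ⟨C, hC, hP⟩ := poincare_H01 (Ω := Ω) hN hΩb
  have hbound (p : H01 Ω) : ‖p‖ ≤ (C + 1) * ‖gradient Ω p‖ := by
    rw [gradient_apply]
    have h1 := hP p.1 p.2
    have h2 : ‖p.1.2‖ ≤ ‖(WithLp.toLp 2 p.1.2 : PiLp 2 fun _ => L2 Ω)‖ :=
      (pi_norm_le_iff_of_nonneg (norm_nonneg _)).2 fun i =>
        PiLp.norm_apply_le (WithLp.toLp 2 p.1.2 : PiLp 2 fun _ => L2 Ω) i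
    refine max_le (h1.trans ?_) (h2.trans ?_)
    · gcongr; linarith
    · exact le_mul_of_one_le_left (norm_nonneg _) (by linarith)
  -- By Poincaré the gradient is bounded below, so its range is closed. This range, with the L²
  -- inner product of gradients, serves as the Hilbert space, since `H01` only carries the sup norm
  -- of a product.
  have hanti : AntilipschitzWith (C + 1).toNNReal (gradient Ω) :=
    AddMonoidHomClass.antilipschitz_of_bound (gradient Ω) fun p => by
      rw [Real.coe_toNNReal _ (by linarith)]; exact hbound p
  have : CompleteSpace (H01 Ω) :=
    (Submodule.isClosed_topologicalClosure (testPairs Ω)).completeSpace_coe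
  have hclosed : IsClosed ((gradient Ω).range : Set (PiLp 2 fun _ : Fin N => L2 Ω)) :=
    hanti.isClosed_range (gradient Ω).uniformContinuous
  have : CompleteSpace (gradient Ω).range := hclosed.completeSpace_coe
  let e : H01 Ω ≃ₗ[ℂ] (gradient Ω).range :=
    LinearEquiv.ofInjective (gradient Ω).toLinearMap hanti.injective
  have he (g : (gradient Ω).range) : gradient Ω (e.symm g) = g :=
    congrArg Subtype.val (e.apply_symm_apply g)
  -- J recovers u from ∇u. The solution operator is B = J J*, so its positivity is automatic.
  let J₀ : (gradient Ω).range →ₗ[ℂ] L2 Ω :=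
    LinearMap.fst ℂ (L2 Ω) (Fin N → L2 Ω) ∘ₗ (H01 Ω).subtype ∘ₗ
      e.symm.toLinearMap
  have hJ₀ (g : (gradient Ω).range) : ‖J₀ g‖ ≤ C * ‖g‖ := by
    have h := hP (e.symm g).1 (e.symm g).2
    rw [← gradient_apply, he] at h
    exact h
  obtain ⟨J, hJ⟩ : ∃ J : (gradient Ω).range →L[ℂ] L2 Ω, ∀ g, J g = (e.symm g).1.1 :=
    ⟨LinearMap.mkContinuous J₀ C hJ₀, fun _ => rfl⟩
  obtain ⟨B, hB, J', hBJ, hJ'⟩ := exists_nonneg_comp_adjoint _ J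
  refine ⟨B, hB, fun f => ?_⟩
  rw [hBJ, hJ]
  refine ⟨(e.symm (J' f)).1.2, (e.symm (J' f)).2, fun q hq => ?_⟩
  -- The adjoint relation ⟨∇q, J*f⟩ = ⟨q, f⟩ is precisely the weak equation.
  have h := hJ' (e ⟨q, Submodule.le_topologicalClosure _ hq⟩) f
  rw [hJ, e.symm_apply_apply, ← he (J' f), PiLp.inner_apply] at h
  exact h

/-- The Dirichlet Laplacian has a bounded positive inverse. -/
theorem exists_isBoundedInverse_dirichletLaplacian (hN : 3 ≤ N) (hΩ : IsOpen Ω)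
    (hΩb : Bornology.IsBounded Ω) :
    ∃ B : L2 Ω →L[ℂ] L2 Ω, 0 ≤ B ∧ IsBoundedInverse (dirichletLaplacian Ω) B := by
  obtain ⟨B, hB, h⟩ := exists_nonneg_solution (Ω := Ω) hN hΩb
  have hgraph : (dirichletLaplacian Ω).graph = dirichletGraph Ω :=
    Submodule.toLinearPMap_graph_eq _ (dirichletGraph_snd_eq_zero hΩ)
  refine ⟨B, hB, fun y => ?_, fun x => ?_⟩
  · have hy : (B y, y) ∈ (dirichletLaplacian Ω).graph := hgraph ▸ h y
    have hd := LinearPMap.mem_domain_of_mem_graph hy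
    exact ⟨hd, ((LinearPMap.image_iff hd).2 hy).symm⟩
  · have hx : ((x : L2 Ω), dirichletLaplacian Ω x) ∈ dirichletGraph Ω :=
      hgraph ▸ LinearPMap.mem_graph _ x
    have h0 := (dirichletGraph Ω).sub_mem (h (dirichletLaplacian Ω x)) hx
    rw [Prod.mk_sub_mk, sub_self] at h0
    exact sub_eq_zero.1 (dirichletGraph_fst_eq_zero hN hΩb h0)

end Dirichlet

end CoupledWave

end

theorem mainTheorem7 {N : ℕ} (hN : 3 ≤ N) (Ω : Set (EuclideanSpace ℝ (Fin N)))
    (hΩ : IsOpen Ω) (hΩconn : IsConnected Ω) (hΩb : Bornology.IsBounded Ω)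
    (η : ℝ) (hη : 0 < η) (a₀ a₁ : ℝ) (ha₀ : 0 < a₀) (a : ℝ → ℝ → ℝ)
    (ha : ∀ ε ∈ Set.Icc (0 : ℝ) 1, ∀ t : ℝ, a₀ ≤ a ε t ∧ a ε t ≤ a₁) :
    ∃ θ : ℝ, Real.pi / 2 < θ ∧ θ < Real.pi ∧ ∃ C : ℝ, 0 < C ∧
      ∀ ε ∈ Set.Icc (0 : ℝ) 1, ∀ t : ℝ, ∀ μ ∈ CoupledWave.sector θ,
        ∃ R : CoupledWave.Y0 Ω →L[ℂ] CoupledWave.Y0 Ω,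
          CoupledWave.IsBoundedInverse
            (CoupledWave.shift μ (CoupledWave.waveOp Ω η (a ε t))) R ∧
          ‖R‖ ≤ C / (1 + ‖μ‖) := by
  obtain ⟨B, hB, hinv⟩ := CoupledWave.exists_isBoundedInverse_dirichletLaplacian hN hΩ hΩb
  have h₁ : 0 ≤ a₁ := by
    have := ha 0 (by simp) 0
    linarith
  obtain ⟨θ, hθ, hθ', C, hC, H⟩ :=
    CoupledWave.exists_sector_resolvent_bound hinv hB η a₁ hη h₁
  refine ⟨θ, hθ, hθ', C, hC, fun ε hε t μ hμ => H μ hμ (a ε t) ?_⟩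
  have := ha ε hε t
  exact abs_le.2 ⟨by linarith, this.2⟩
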